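/- Let $F:[0,\infty)\to[0,\infty)$ be a non-decreasing sparseness measure, that is, a non-decreasing function such that $F(|x+y|)\le F(|x|)+F(|y|)$ for all $x,y\in\mathbb{R}$, and $F(x)=0$ if and only if $x=0$. For $z\in\mathbb{R}^n$ and $T\subseteq\{1,\dots,n\}$ put $J(z_T)=\sum_{i\in T}F(|z_i|)$. Let $G_l(\mathbb{R}^n)$ be the Grassmann manifold of $l$-dimensional linear subspaces of $\mathbb{R}^n$, with the metric $\operatorname{dist}(\nu,\nu')=\|P_\nu-P_{\nu'}\|$ (spectral norm of the difference of the orthogonal projections) and with the smooth structure given by the standard charts $(U_I,\varphi_I)$: here $I\subseteq\{1,\dots,n\}$, $|I|=l$, $U_I$ is the set of column spaces of the $n\times l$ matrices $Y$ whose submatrix $Y_I$ of rows indexed by $I$ is invertible, and $\varphi_I$ sends the column space of such a $Y$ to the rows of $YY_I^{-1}$ indexed by the complement of $I$, an $(n-l)\times l$ matrix. For $k\ge 0$ let $$\Omega_J=\{\nu\in G_l(\mathbb{R}^n) : J(z_T)<J(z_{T^c})\ \text{ for all } z\in\nu\setminus\{0\} \text{ and all } T\subseteq\{1,\dots,n\}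 \text{ with } |T|\le k\}.$$ Then the set $\overline{\Omega}_J\setminus\operatorname{int}(\Omega_J)$ has measure zero in $G_l(\mathbb{R}^n)$, i.e. $\varphi\big((\overline{\Omega}_J\setminus\operatorname{int}(\Omega_J))\cap U\big)$ has Lebesgue measure zero for every chart $(U,\varphi)$ of the smooth structure, and it is of the first category (a countable union of nowhere dense sets) in $G_l(\mathbb{R}^n)$. -/

import Mathlib

open MeasureTheory
open scoped NNReal Matrix Manifold ContDiff

namespace SparseRecovery

/-! ### Sparseness measures and cost functions -/

/-- A sparseness measure is a function `F : [0, ∞) → [0, ∞)` such that `F(|·|)` is subadditive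
on `ℝ` and `F` vanishes exactly at `0`. -/
structure IsSparsenessMeasure (F : ℝ≥0 → ℝ≥0) : Prop where
  subadd : ∀ x y : ℝ, F (Real.nnabs (x + y)) ≤ F (Real.nnabs x) + F (Real.nnabs y)
  eq_zero_iff : ∀ x : ℝ≥0, F x = 0 ↔ x = 0

/-- The partial cost `J(z_T) = ∑_{i ∈ T} F(|z_i|)`. -/
noncomputable def cost {n : ℕ} (F : ℝ≥0 → ℝ≥0) (T : Finset (Fin n))
    (z : EuclideanSpace ℝ (Fin n)) : ℝ≥0 :=
  ∑ i ∈ T, F (Real.nnabs (z i))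

/-! ### The Grassmannian as a metric space -/

/-- The Grassmannian `G_l(ℝⁿ)` of `l`-dimensional linear subspaces of `ℝⁿ`. -/
@[ext]
structure Grassmannian (n l : ℕ) where
  /-- The underlying linear subspace. -/
  toSubmodule : Submodule ℝ (EuclideanSpace ℝ (Fin n))
  finrank_eq : Module.finrank ℝ toSubmodule = l

namespace Grassmannian

variable {n l : ℕ}

theorem starProjection_injective :
    Function.Injective fun ν : Grassmannian n l => ν.toSubmodule.starProjection := by
  intro ν ν' h
  apply Grassmannian.ext
  have h' : ν.toSubmodule.starProjection = ν'.toSubmodule.starProjection := h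
  rw [← Submodule.range_starProjection ν.toSubmodule, ← Submodule.range_starProjection ν'.toSubmodule, h']

/-- The metric `dist ν ν' = ‖P_ν - P_ν'‖`, where `P_ν` is the orthogonal projection onto `ν` and
`‖·‖` is the operator (spectral) norm. -/
noncomputable instance : MetricSpace (Grassmannian n l) :=
  MetricSpace.induced (fun ν => ν.toSubmodule.starProjection) starProjection_injective inferInstance

theorem dist_eq (ν ν' : Grassmannian n l) :
    dist ν ν' = ‖ν.toSubmodule.starProjection - ν'.toSubmodule.starProjection‖ :=
  dist_eq_norm ν.toSubmodule.starProjection ν'.toSubmodule.starProjection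

/-! ### Charts -/

/-- The index sets `I = {i₁ < ⋯ < i_l} ⊆ {1, …, n}`. -/
structure IndexSet (n l : ℕ) where
  /-- The underlying finite set. -/
  toFinset : Finset (Fin n)
  card_eq : toFinset.card = l

theorem IndexSet.card_compl (I : IndexSet n l) : (I.toFinsetᶜ).card = n - l := by
  rw [Finset.card_compl, Fintype.card_fin, I.card_eq]

/-- The increasing enumeration of `I`. -/
def IndexSet.row (I : IndexSet n l) : Fin l ↪o Fin n := I.toFinset.orderEmbOfFin I.card_eq

/-- The increasing enumeration of the complement of `I`. -/
def IndexSet.coRow (I : IndexSet n l) : Fin (n - l) ↪o Fin n :=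
  I.toFinsetᶜ.orderEmbOfFin I.card_compl

/-- The column space of an `n × l` matrix. -/
def colSpan (Y : Matrix (Fin n) (Fin l) ℝ) : Submodule ℝ (EuclideanSpace ℝ (Fin n)) :=
  Submodule.span ℝ (Set.range fun j : Fin l => WithLp.toLp 2 (Y.col j))

/-- The chart domain `U_I`: the subspaces which are the column space of a matrix `Y` whose rows
indexed by `I` form an invertible matrix `Y_I`. -/
def chartDomain (I : IndexSet n l) : Set (Grassmannian n l) :=
  {ν | ∃ Y : Matrix (Fin n) (Fin l) ℝ, colSpan Y = ν.toSubmodule ∧ (Y.submatrix I.row id).det ≠ 0}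

/-- The space `𝕄(n-l, l)` of `(n-l) × l` real matrices, in which the charts take their values. -/
abbrev Model (n l : ℕ) : Type := Fin (n - l) → Fin l → ℝ

/-- The rows indexed by the complement of `I` of the matrix `Y Y_I⁻¹`. -/
noncomputable def normalForm (I : IndexSet n l) (Y : Matrix (Fin n) (Fin l) ℝ) : Model n l :=
  (Y * (Y.submatrix I.row id)⁻¹).submatrix I.coRow id

open Classical in
/-- The coordinate map `φ_I : U_I → 𝕄(n-l, l)`, `ν ↦ (Y Y_I⁻¹)_{Iᶜ}` where `Y` is any matrix with
column space `ν` (extended by `0` outside `U_I`). -/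
noncomputable def coord (I : IndexSet n l) (ν : Grassmannian n l) : Model n l :=
  if h : ν ∈ chartDomain I then normalForm I h.choose else 0

/-- The `n × l` matrix `X` with `X_I = 1` and `X_{Iᶜ} = M`. -/
noncomputable def stack (I : IndexSet n l) (M : Model n l) : Matrix (Fin n) (Fin l) ℝ :=
  fun i j =>
    if h : i ∈ I.toFinset then
      (1 : Matrix (Fin l) (Fin l) ℝ) ((I.toFinset.orderIsoOfFin I.card_eq).symm ⟨i, h⟩) j
    else M ((I.toFinsetᶜ.orderIsoOfFin I.card_compl).symm ⟨i, Finset.mem_compl.2 h⟩) j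

/-! ### The charts are homeomorphisms onto `𝕄(n-l, l)` -/

theorem mem_colSpan {Y : Matrix (Fin n) (Fin l) ℝ} {x : EuclideanSpace ℝ (Fin n)} :
    x ∈ colSpan Y ↔ ∃ c : Fin l → ℝ, WithLp.toLp 2 (Y *ᵥ c) = x := by
  rw [colSpan, Submodule.mem_span_range_iff_exists_fun]
  refine exists_congr fun c => ?_
  have : ∑ i, c i • (WithLp.toLp 2 (Y.col i) : EuclideanSpace ℝ (Fin n))
      = WithLp.toLp 2 (Y *ᵥ c) := by
    ext a
    simp [Matrix.mulVec, dotProduct, mul_comm]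
  rw [this]

theorem row_mem (I : IndexSet n l) (a : Fin l) : I.row a ∈ I.toFinset :=
  Finset.orderEmbOfFin_mem _ _ _

theorem coRow_notMem (I : IndexSet n l) (a : Fin (n - l)) : I.coRow a ∉ I.toFinset :=
  Finset.mem_compl.1 (Finset.orderEmbOfFin_mem _ I.card_compl a)

theorem stack_row (I : IndexSet n l) (M : Model n l) : (stack I M).submatrix I.row id = 1 := by
  ext a j
  have : (I.toFinset.orderIsoOfFin I.card_eq).symm ⟨I.row a, row_mem I a⟩ = a := by
    rw [OrderIso.symm_apply_eq]
    rfl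
  simp only [stack, Matrix.submatrix_apply, row_mem, dif_pos, id]
  exact congrFun (congrArg _ this) j

theorem stack_coRow (I : IndexSet n l) (M : Model n l) :
    (stack I M).submatrix I.coRow id = M := by
  ext a j
  have : (⟨I.coRow a, Finset.mem_compl.2 (coRow_notMem I a)⟩ : (I.toFinsetᶜ : Finset (Fin n)))
      = I.toFinsetᶜ.orderIsoOfFin I.card_compl a := rfl
  simp only [stack, Matrix.submatrix_apply, coRow_notMem, not_false_eq_true, dif_neg, this,
    OrderIso.symm_apply_apply, id]

theorem matrix_ext_rows (I : IndexSet n l) {X Y : Matrix (Fin n) (Fin l) ℝ}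
    (h₁ : X.submatrix I.row id = Y.submatrix I.row id)
    (h₂ : X.submatrix I.coRow id = Y.submatrix I.coRow id) : X = Y := by
  ext i j
  by_cases hi : i ∈ I.toFinset
  · obtain ⟨a, ha⟩ : i ∈ Set.range I.row := by
      rw [IndexSet.row, Finset.range_orderEmbOfFin]; exact hi
    subst ha
    exact congrFun (congrFun h₁ a) j
  · obtain ⟨a, ha⟩ : i ∈ Set.range I.coRow := by
      rw [IndexSet.coRow, Finset.range_orderEmbOfFin]; simpa using hi
    subst ha
    exact congrFun (congrFun h₂ a) j

theorem mulVec_injective_of_det {I : IndexSet n l} {Y : Matrix (Fin n) (Fin l) ℝ}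
    (h : (Y.submatrix I.row id).det ≠ 0) : Function.Injective Y.mulVec := by
  intro c d hcd
  apply Matrix.mulVec_injective_of_det_ne_zero h
  funext a
  exact congrFun hcd (I.row a)

theorem finrank_colSpan {Y : Matrix (Fin n) (Fin l) ℝ} (h : Function.Injective Y.mulVec) :
    Module.finrank ℝ (colSpan Y) = l := by
  have hli : LinearIndependent ℝ fun j : Fin l =>
      (WithLp.toLp 2 (Y.col j) : EuclideanSpace ℝ (Fin n)) := by
    have h1 : LinearIndependent ℝ Y.col := Matrix.mulVec_injective_iff.1 h
    exact h1.map' (WithLp.linearEquiv 2 ℝ (Fin n → ℝ)).symm.toLinearMap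
      (LinearMap.ker_eq_bot.2 (LinearEquiv.injective _))
  rw [colSpan, finrank_span_eq_card hli, Fintype.card_fin]

theorem exists_colSpan (ν : Grassmannian n l) :
    ∃ Y : Matrix (Fin n) (Fin l) ℝ, colSpan Y = ν.toSubmodule ∧ Function.Injective Y.mulVec := by
  let b := Module.finBasisOfFinrankEq ℝ ν.toSubmodule ν.finrank_eq
  have hspan : Submodule.span ℝ (Set.range fun j => (b j : EuclideanSpace ℝ (Fin n))) = ν.toSubmodule := by
    have : (Set.range fun j => (b j : EuclideanSpace ℝ (Fin n))) = ν.toSubmodule.subtype '' Set.range b := by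
      rw [← Set.range_comp]; rfl
    rw [this, Submodule.span_image, b.span_eq, Submodule.map_top, Submodule.range_subtype]
  refine ⟨Matrix.of fun i j => (b j : EuclideanSpace ℝ (Fin n)) i, hspan, ?_⟩
  rw [Matrix.mulVec_injective_iff]
  have h1 : LinearIndependent ℝ fun j => (b j : EuclideanSpace ℝ (Fin n)) :=
    b.linearIndependent.map' ν.toSubmodule.subtype (Submodule.ker_subtype _)
  exact h1.map' (WithLp.linearEquiv 2 ℝ (Fin n → ℝ)).toLinearMap
      (LinearMap.ker_eq_bot.2 (LinearEquiv.injective _))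

theorem isUnit_gram {Y : Matrix (Fin n) (Fin l) ℝ} (h : Function.Injective Y.mulVec) :
    IsUnit (Yᵀ * Y).det := by
  rw [← Matrix.isUnit_iff_isUnit_det, ← Matrix.mulVec_injective_iff_isUnit]
  have : LinearMap.ker (Yᵀ * Y).mulVecLin = ⊥ := by
    rw [Matrix.ker_mulVecLin_transpose_mul_self]
    exact LinearMap.ker_eq_bot.2 h
  exact LinearMap.ker_eq_bot.1 this

/-- The projection onto the column space of `Y` is `Y (Yᵀ Y)⁻¹ Yᵀ`. -/
theorem starProjection_colSpan {Y : Matrix (Fin n) (Fin l) ℝ} (h : Function.Injective Y.mulVec) :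
    (colSpan Y).starProjection
      = Matrix.toEuclideanCLM (n := Fin n) (𝕜 := ℝ) (Y * (Yᵀ * Y)⁻¹ * Yᵀ) := by
  ext1 x
  apply Submodule.eq_starProjection_of_mem_of_inner_eq_zero
  · rw [mem_colSpan]
    refine ⟨((Yᵀ * Y)⁻¹ * Yᵀ) *ᵥ x.ofLp, ?_⟩
    rw [Matrix.mulVec_mulVec, ← Matrix.mul_assoc]
    rfl
  · intro w hw
    obtain ⟨c, rfl⟩ := mem_colSpan.1 hw
    have key : Yᵀ *ᵥ (x.ofLp - (Y * (Yᵀ * Y)⁻¹ * Yᵀ) *ᵥ x.ofLp) = 0 := by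
      rw [Matrix.mulVec_sub, Matrix.mulVec_mulVec, ← Matrix.mul_assoc, ← Matrix.mul_assoc,
        Matrix.mul_nonsing_inv _ (isUnit_gram h), Matrix.one_mul, sub_self]
    rw [EuclideanSpace.inner_eq_star_dotProduct]
    simp only [star_trivial, WithLp.ofLp_sub, Matrix.ofLp_toEuclideanCLM]
    rw [dotProduct_comm, Matrix.dotProduct_mulVec, ← Matrix.mulVec_transpose, key,
      zero_dotProduct]

/-- The matrix of the orthogonal projection onto `ν`. -/
noncomputable def projMatrix (ν : Grassmannian n l) : Matrix (Fin n) (Fin n) ℝ :=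
  (Matrix.toEuclideanCLM (n := Fin n) (𝕜 := ℝ)).symm ν.toSubmodule.starProjection

theorem continuous_projMatrix : Continuous (projMatrix : Grassmannian n l → _) := by
  have h1 : Continuous fun ν : Grassmannian n l => ν.toSubmodule.starProjection :=
    continuous_induced_dom
  have h2 : Continuous (Matrix.toEuclideanCLM (n := Fin n) (𝕜 := ℝ)).symm :=
    LinearMap.continuous_of_finiteDimensional
      ((Matrix.toEuclideanCLM (n := Fin n) (𝕜 := ℝ)).symm.toAlgEquiv.toLinearMap)
  exact h2.comp h1

theorem projMatrix_eq {ν : Grassmannian n l} {Y : Matrix (Fin n) (Fin l) ℝ}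
    (hY : colSpan Y = ν.toSubmodule) (h : Function.Injective Y.mulVec) :
    projMatrix ν = Y * (Yᵀ * Y)⁻¹ * Yᵀ := by
  obtain ⟨ν, hν⟩ := ν
  change colSpan Y = ν at hY
  subst hY
  rw [projMatrix, starProjection_colSpan h, StarAlgEquiv.symm_apply_apply]

/-- The columns indexed by `I` of the projection matrix. -/
noncomputable def projCols (I : IndexSet n l) (ν : Grassmannian n l) :
    Matrix (Fin n) (Fin l) ℝ :=
  (projMatrix ν).submatrix id I.row

theorem projCols_eq (I : IndexSet n l) {ν : Grassmannian n l} {Y : Matrix (Fin n) (Fin l) ℝ}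
    (hY : colSpan Y = ν.toSubmodule) (h : Function.Injective Y.mulVec) :
    projCols I ν = Y * ((Yᵀ * Y)⁻¹ * (Y.submatrix I.row id)ᵀ) := by
  rw [projCols, projMatrix_eq hY h, Matrix.mul_assoc]
  rfl

theorem projCols_row_eq (I : IndexSet n l) {ν : Grassmannian n l}
    {Y : Matrix (Fin n) (Fin l) ℝ} (hY : colSpan Y = ν.toSubmodule) (h : Function.Injective Y.mulVec) :
    (projCols I ν).submatrix I.row id
      = Y.submatrix I.row id * ((Yᵀ * Y)⁻¹ * (Y.submatrix I.row id)ᵀ) := by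
  rw [projCols_eq I hY h]
  rfl

theorem mem_chartDomain_iff (I : IndexSet n l) (ν : Grassmannian n l) :
    ν ∈ chartDomain I ↔ ((projCols I ν).submatrix I.row id).det ≠ 0 := by
  constructor
  · rintro ⟨Y, hY, hdet⟩
    have h := mulVec_injective_of_det hdet
    rw [projCols_row_eq I hY h, Matrix.det_mul, Matrix.det_mul, Matrix.det_transpose]
    have h2 : ((Yᵀ * Y)⁻¹).det ≠ 0 :=
      ((Matrix.isUnit_nonsing_inv_det_iff).2 (isUnit_gram h)).ne_zero
    exact mul_ne_zero hdet (mul_ne_zero h2 hdet)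
  · intro hdet
    obtain ⟨Y, hY, h⟩ := exists_colSpan ν
    rw [projCols_row_eq I hY h, Matrix.det_mul] at hdet
    exact ⟨Y, hY, left_ne_zero_of_mul hdet⟩

theorem det_ne_zero_of_mem {I : IndexSet n l} {ν : Grassmannian n l}
    (hν : ν ∈ chartDomain I) {Y : Matrix (Fin n) (Fin l) ℝ} (hY : colSpan Y = ν.toSubmodule)
    (h : Function.Injective Y.mulVec) : (Y.submatrix I.row id).det ≠ 0 := by
  rw [mem_chartDomain_iff, projCols_row_eq I hY h, Matrix.det_mul] at hν
  exact left_ne_zero_of_mul hν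

/-- `Y Y_I⁻¹` is unchanged when `Y` is multiplied on the right by an invertible matrix. -/
theorem normalForm_mul (I : IndexSet n l) (Y : Matrix (Fin n) (Fin l) ℝ)
    {V : Matrix (Fin l) (Fin l) ℝ} (hV : IsUnit V.det) :
    normalForm I (Y * V) = normalForm I Y := by
  have h1 : (Y * V).submatrix I.row id = Y.submatrix I.row id * V := rfl
  rw [normalForm, normalForm, h1, Matrix.mul_inv_rev, ← Matrix.mul_assoc, Matrix.mul_assoc Y V,
    Matrix.mul_nonsing_inv _ hV, Matrix.mul_one]

theorem normalForm_projCols (I : IndexSet n l) {ν : Grassmannian n l}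
    {Y : Matrix (Fin n) (Fin l) ℝ} (hY : colSpan Y = ν.toSubmodule)
    (hdet : (Y.submatrix I.row id).det ≠ 0) :
    normalForm I (projCols I ν) = normalForm I Y := by
  have h := mulVec_injective_of_det hdet
  rw [projCols_eq I hY h]
  apply normalForm_mul
  rw [Matrix.det_mul, Matrix.det_transpose]
  exact ((Matrix.isUnit_nonsing_inv_det_iff).2 (isUnit_gram h)).mul hdet.isUnit

/-- The coordinates do not depend on the choice of the matrix `Y`. -/
theorem coord_eq (I : IndexSet n l) {ν : Grassmannian n l} {Y : Matrix (Fin n) (Fin l) ℝ}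
    (hY : colSpan Y = ν.toSubmodule) (hdet : (Y.submatrix I.row id).det ≠ 0) :
    coord I ν = normalForm I Y := by
  have hν : ν ∈ chartDomain I := ⟨Y, hY, hdet⟩
  rw [coord, dif_pos hν, ← normalForm_projCols I hY hdet,
    ← normalForm_projCols I hν.choose_spec.1 hν.choose_spec.2]

theorem det_stack_row (I : IndexSet n l) (M : Model n l) :
    ((stack I M).submatrix I.row id).det ≠ 0 := by
  rw [stack_row, Matrix.det_one]
  exact one_ne_zero

/-- The inverse chart: `M` is sent to the column space of the matrix `X` with `X_I = 1` and
`X_{Iᶜ} = M`. -/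
noncomputable def coordInv (I : IndexSet n l) (M : Model n l) : Grassmannian n l :=
  ⟨colSpan (stack I M), finrank_colSpan (mulVec_injective_of_det (det_stack_row I M))⟩

theorem coordInv_mem (I : IndexSet n l) (M : Model n l) : coordInv I M ∈ chartDomain I :=
  ⟨stack I M, rfl, det_stack_row I M⟩

theorem coord_coordInv (I : IndexSet n l) (M : Model n l) : coord I (coordInv I M) = M := by
  rw [coord_eq (ν := coordInv I M) I rfl (det_stack_row I M), normalForm, stack_row, inv_one,
    Matrix.mul_one, stack_coRow]

theorem colSpan_mul (Y : Matrix (Fin n) (Fin l) ℝ) {V : Matrix (Fin l) (Fin l) ℝ}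
    (hV : IsUnit V.det) : colSpan (Y * V) = colSpan Y := by
  ext x
  rw [mem_colSpan, mem_colSpan]
  constructor
  · rintro ⟨c, rfl⟩
    exact ⟨V *ᵥ c, by rw [Matrix.mulVec_mulVec]⟩
  · rintro ⟨c, rfl⟩
    refine ⟨V⁻¹ *ᵥ c, ?_⟩
    rw [Matrix.mulVec_mulVec, Matrix.mul_assoc, Matrix.mul_nonsing_inv _ hV, Matrix.mul_one]

theorem coordInv_coord (I : IndexSet n l) {ν : Grassmannian n l} (hν : ν ∈ chartDomain I) :
    coordInv I (coord I ν) = ν := by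
  obtain ⟨Y, hY, hdet⟩ := hν
  have hstack : stack I (coord I ν) = Y * (Y.submatrix I.row id)⁻¹ := by
    apply matrix_ext_rows I
    · rw [stack_row]
      exact (Matrix.mul_nonsing_inv _ hdet.isUnit).symm
    · rw [stack_coRow, coord_eq I hY hdet]
      rfl
  apply Grassmannian.ext
  change colSpan (stack I (coord I ν)) = ν.toSubmodule
  rw [hstack, colSpan_mul _ ((Matrix.isUnit_nonsing_inv_det_iff).2 hdet.isUnit), hY]

theorem continuous_projCols (I : IndexSet n l) :
    Continuous (projCols I : Grassmannian n l → _) :=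
  continuous_projMatrix.matrix_submatrix _ _

theorem isOpen_chartDomain (I : IndexSet n l) : IsOpen (chartDomain I) := by
  have : chartDomain I = {ν | ((projCols I ν).submatrix I.row id).det ≠ 0} :=
    Set.ext fun ν => mem_chartDomain_iff I ν
  rw [this]
  exact isOpen_ne_fun ((continuous_projCols I).matrix_submatrix _ _).matrix_det continuous_const

/-- Matrix inversion is smooth, entry by entry, along smooth families of invertible matrices. -/
theorem contDiffOn_inv_apply {E : Type*} [NormedAddCommGroup E] [NormedSpace ℝ E] {s : Set E}
    {A : E → Matrix (Fin l) (Fin l) ℝ} (hA : ∀ i j, ContDiffOn ℝ ∞ (fun x => A x i j) s)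
    (hdet : ∀ x ∈ s, (A x).det ≠ 0) (i j : Fin l) :
    ContDiffOn ℝ ∞ (fun x => (A x)⁻¹ i j) s := by
  have hd : ∀ B : E → Matrix (Fin l) (Fin l) ℝ,
      (∀ i j, ContDiffOn ℝ ∞ (fun x => B x i j) s) → ContDiffOn ℝ ∞ (fun x => (B x).det) s := by
    intro B hB
    simp only [Matrix.det_apply]
    refine ContDiffOn.sum fun σ _ => ?_
    exact (contDiffOn_prod fun k _ => hB _ _).const_smul _
  have hadj : ContDiffOn ℝ ∞ (fun x => (A x).adjugate i j) s := by
    simp only [Matrix.adjugate_apply]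
    refine hd _ fun a b => ?_
    by_cases hab : a = j
    · subst hab
      simp only [Matrix.updateRow_self]
      exact contDiffOn_const
    · simp only [Matrix.updateRow_ne hab]
      exact hA a b
  have h : ContDiffOn ℝ ∞ (fun x => (A x).det⁻¹ * (A x).adjugate i j) s :=
    ((hd A hA).inv hdet).mul hadj
  refine h.congr fun x hx => ?_
  simp [Matrix.inv_def, Ring.inverse_eq_inv']

theorem continuousOn_matrix_inv {X : Type*} [TopologicalSpace X] {s : Set X}
    {A : X → Matrix (Fin l) (Fin l) ℝ} (hA : ContinuousOn A s)
    (hdet : ∀ x ∈ s, (A x).det ≠ 0) : ContinuousOn (fun x => (A x)⁻¹) s := by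
  have h : ContinuousOn (fun x => (A x).det⁻¹ • (A x).adjugate) s :=
    ContinuousOn.smul
      (ContinuousOn.inv₀ ((continuous_id.matrix_det).comp_continuousOn hA) hdet)
      ((continuous_id.matrix_adjugate).comp_continuousOn hA)
  refine h.congr fun x _ => ?_
  simp [Matrix.inv_def, Ring.inverse_eq_inv']

theorem continuousOn_coord (I : IndexSet n l) : ContinuousOn (coord I) (chartDomain I) := by
  have h1 : ContinuousOn
      (fun ν => ((projCols I ν) * ((projCols I ν).submatrix I.row id)⁻¹).submatrix I.coRow id)
      (chartDomain I) := by
    have hinv := continuousOn_matrix_inv (s := chartDomain I)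
      ((continuous_projCols I).matrix_submatrix I.row id).continuousOn
      fun ν hν => (mem_chartDomain_iff I ν).1 hν
    have hmul : ContinuousOn
        (fun ν => (projCols I ν) * ((projCols I ν).submatrix I.row id)⁻¹) (chartDomain I) := by
      rw [continuousOn_iff_continuous_domRestrict] at hinv ⊢
      exact ((continuous_projCols I).comp continuous_subtype_val).matrix_mul hinv
    exact (continuous_id.matrix_submatrix I.coRow id).comp_continuousOn hmul
  refine h1.congr fun ν hν => ?_
  obtain ⟨Y, hY, hdet⟩ := hν
  rw [coord_eq I hY hdet, ← normalForm_projCols I hY hdet]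
  rfl

theorem contDiff_stack_apply (I : IndexSet n l) (i : Fin n) (j : Fin l) :
    ContDiff ℝ ∞ fun M : Model n l => stack I M i j := by
  by_cases h : i ∈ I.toFinset
  · simp only [stack, h, dif_pos]
    exact contDiff_const
  · simp only [stack, h, dif_neg, not_false_eq_true]
    exact contDiff_apply_apply ℝ ℝ _ _

theorem continuous_coordInv (I : IndexSet n l) : Continuous (coordInv I) := by
  rw [continuous_induced_rng]
  have hstack : Continuous (stack I) :=
    continuous_matrix fun i j => (contDiff_stack_apply I i j).continuous
  have hinv : Continuous fun M => ((stack I M)ᵀ * stack I M)⁻¹ := by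
    rw [← continuousOn_univ]
    exact continuousOn_matrix_inv (hstack.matrix_transpose.matrix_mul hstack).continuousOn
      fun M _ => (isUnit_gram (mulVec_injective_of_det (det_stack_row I M))).ne_zero
  have hlin : Continuous (Matrix.toEuclideanCLM (n := Fin n) (𝕜 := ℝ)) :=
    LinearMap.continuous_of_finiteDimensional
      ((Matrix.toEuclideanCLM (n := Fin n) (𝕜 := ℝ)).toAlgEquiv.toLinearMap)
  have h := hlin.comp ((hstack.matrix_mul hinv).matrix_mul hstack.matrix_transpose)
  refine h.congr fun M => ?_
  exact (starProjection_colSpan (mulVec_injective_of_det (det_stack_row I M))).symm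

/-- The chart `(U_I, φ_I)`. -/
noncomputable def chart (I : IndexSet n l) :
    OpenPartialHomeomorph (Grassmannian n l) (Model n l) where
  toFun := coord I
  invFun := coordInv I
  source := chartDomain I
  target := Set.univ
  map_source' _ _ := Set.mem_univ _
  map_target' M _ := coordInv_mem I M
  left_inv' _ hν := coordInv_coord I hν
  right_inv' M _ := coord_coordInv I M
  open_source := isOpen_chartDomain I
  open_target := isOpen_univ
  continuousOn_toFun := continuousOn_coord I
  continuousOn_invFun := (continuous_coordInv I).continuousOn

/-- The domains `U_I` cover the Grassmannian. -/
theorem exists_mem_chartDomain (ν : Grassmannian n l) : ∃ I : IndexSet n l, ν ∈ chartDomain I := by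
  obtain ⟨Y, hY, h⟩ := exists_colSpan ν
  obtain ⟨κ, a, ha, hspan, hli⟩ := exists_linearIndependent' ℝ Y.row
  have : Fintype κ := Fintype.ofInjective a ha
  have hcol : LinearIndependent ℝ Y.col := Matrix.mulVec_injective_iff.1 h
  have hκ : Fintype.card κ = l := by
    rw [← finrank_span_eq_card hli, hspan, ← Matrix.rank_eq_finrank_span_row,
      Matrix.rank_eq_finrank_span_cols, finrank_span_eq_card hcol, Fintype.card_fin]
  let I : IndexSet n l := ⟨Finset.univ.map ⟨a, ha⟩, by rw [Finset.card_map, Finset.card_univ, hκ]⟩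
  have hrow : ∀ i : Fin l, ∃ j : κ, a j = I.row i := by
    intro i
    have := row_mem I i
    simpa [I] using this
  choose b hb using hrow
  have hbinj : Function.Injective b := by
    intro i j hij
    apply I.row.injective
    rw [← hb, ← hb, hij]
  refine ⟨I, Y, hY, ?_⟩
  have hli' : LinearIndependent ℝ (Y.submatrix I.row id).row := by
    have h1 := hli.comp b hbinj
    have h2 : (Y.row ∘ a) ∘ b = (Y.submatrix I.row id).row := by
      funext i
      change Y (a (b i)) = Y (I.row i)
      rw [hb]
    rwa [h2] at h1
  rw [Matrix.linearIndependent_rows_iff_isUnit, Matrix.isUnit_iff_isUnit_det] at hli'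
  exact hli'.ne_zero

/-! ### The smooth structure and sets of measure zero -/

/-- The Grassmannian with the atlas `{(U_I, φ_I)}`. -/
noncomputable instance : ChartedSpace (Model n l) (Grassmannian n l) where
  atlas := Set.range chart
  chartAt ν := chart (exists_mem_chartDomain ν).choose
  mem_chart_source ν := (exists_mem_chartDomain ν).choose_spec
  chart_mem_atlas _ := Set.mem_range_self _

/-- Any two of the charts `(U_I, φ_I)` are `C^∞` compatible. -/
instance : IsManifold 𝓘(ℝ, Model n l) ∞ (Grassmannian n l) := by
  apply isManifold_of_contDiffOn
  rintro _ _ ⟨I, rfl⟩ ⟨K, rfl⟩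
  simp only [mfld_simps]
  have hsub : ∀ i j, ContDiff ℝ ∞ fun M : Model n l => (stack I M).submatrix K.row id i j :=
    fun i j => contDiff_stack_apply I _ _
  have hset : ∀ M ∈ coordInv I ⁻¹' chartDomain K,
      ((stack I M).submatrix K.row id).det ≠ 0 := fun M hM =>
    det_ne_zero_of_mem hM rfl (mulVec_injective_of_det (det_stack_row I M))
  have hfun : ContDiffOn ℝ ∞ (fun M => normalForm K (stack I M))
      (coordInv I ⁻¹' chartDomain K) := by
    rw [contDiffOn_pi]
    intro i
    rw [contDiffOn_pi]
    intro j
    simp only [normalForm, Matrix.submatrix_apply, Matrix.mul_apply]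
    refine ContDiffOn.sum fun c _ => ?_
    exact (contDiff_stack_apply I _ _).contDiffOn.mul
      (contDiffOn_inv_apply (fun i j => (hsub i j).contDiffOn) hset _ _)
  have hcongr : ContDiffOn ℝ ∞ (fun M => coord K (coordInv I M))
      (coordInv I ⁻¹' chartDomain K) :=
    hfun.congr fun M hM => coord_eq (ν := coordInv I M) K rfl (hset M hM)
  exact hcongr.mono fun M hM => hM.2

/-- A subset `A` of the Grassmannian has measure zero if `φ(A ∩ U)` has Lebesgue measure zero for
every chart `(U, φ)` of its smooth structure. -/
def HasMeasureZero (A : Set (Grassmannian n l)) : Prop :=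
  ∀ φ ∈ IsManifold.maximalAtlas 𝓘(ℝ, Model n l) ∞ (Grassmannian n l),
    volume (φ '' (A ∩ φ.source)) = 0

end Grassmannian

/-! ### The exact recovery set -/

/-- The set `Ω_J(n, k, l)` of those `ν ∈ G_l(ℝⁿ)` with `J(z_T) < J(z_{Tᶜ})` for all nonzero `z ∈ ν`
and all `T` with at most `k` elements. -/
def exactRecoverySet (F : ℝ≥0 → ℝ≥0) (n k l : ℕ) : Set (Grassmannian n l) :=
  {ν | ∀ z ∈ ν.toSubmodule, z ≠ 0 → ∀ T : Finset (Fin n), T.card ≤ k → cost F T z < cost F Tᶜ z}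

end SparseRecovery

namespace SparseRecovery

open Filter Metric Topology
open scoped Pointwise

/-! ### Null sets -/

/-! The set is a finite intersection over `T` of the sets `recoverySet l F T`, so its boundary lies
in the union of their boundaries and one `T` may be fixed. Failing the condition for `T` means
containing a nonzero vector of the cone `badCone F T`. Since `F` is monotone, this cone is stable
under enlarging entries on `T` and shrinking entries off `T`.

By compactness of the sphere, a subspace ν outside the interior contains a nonzero vector u of the
closure of the cone. Push u by r, outwards on `T` and inwards off `T`. Every vector within r/2 of
the result lies in the cone, provided that the zero entries of u off `T`, which cannot shrink, stay
exactly zero. In a chart whose index set K contains those zero indices this can be arranged: the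
K-coordinates of a vector are its coefficients, whatever the point of the chart. Moving ν by O(r)
then reaches a ball of radius κr of subspaces that fail the condition
(`exists_closedBall_notMem_recoverySet`). The boundary is thus porous there, and null by Lebesgue
density (`measure_eq_zero_of_porous`).

A suitable K exists when ν lies in every standard chart domain (`exists_superset_of_generic`); the
other subspaces form a null set, given by vanishing minors (`hasMeasureZero_compl_chartDomain`).
Finally, a boundary is closed, and a closed null set is nowhere dense. -/

/-- A set which is porous at each of its points is a null set. -/
theorem measure_eq_zero_of_porous {X : Type*} [PseudoMetricSpace X] [MeasurableSpace X]
    [SecondCountableTopology X] [BorelSpace X] (μ : Measure X) [IsUnifLocDoublingMeasure μ]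
    [IsLocallyFiniteMeasure μ] {E : Set X}
    (h : ∀ x ∈ E, ∃ C : ℝ, ∃ κ > 0, ∃ r₀ > 0, ∀ r, 0 < r → r < r₀ → ∃ y,
      dist x y ≤ C * r ∧ Disjoint E (closedBall y (κ * r))) : μ E = 0 := by
  -- The porosity constants depend on the point, while the density theorem fixes the eccentricity K
  -- before discarding a null set. Quantifying over natural K, later chosen at least C / κ, covers
  -- all points at once.
  have hae : ∀ᵐ x ∂μ.restrict E, ∀ K : ℕ, ∀ (w : ℝ → X) (δ : ℝ → ℝ),
      Tendsto δ (𝓝[>] 0) (𝓝[>] 0) →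
      (∀ᶠ j in 𝓝[>] (0 : ℝ), x ∈ closedBall (w j) (K * δ j)) →
      Tendsto (fun j => μ (E ∩ closedBall (w j) (δ j)) / μ (closedBall (w j) (δ j)))
        (𝓝[>] 0) (𝓝 1) := by
    rw [ae_all_iff]
    intro K
    filter_upwards [IsUnifLocDoublingMeasure.ae_tendsto_measure_inter_div μ E K] with x hx w δ h₁ h₂
      using hx w δ h₁ h₂
  rw [ae_iff] at hae
  refine measure_mono_null ?_ (le_antisymm ((Measure.le_restrict_apply _ _).trans hae.le) bot_le)
  intro x hx
  refine ⟨?_, hx⟩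
  intro hdens
  obtain ⟨C, κ, hκ, r₀, hr₀, hpor⟩ := h x hx
  have : Nonempty X := ⟨x⟩
  choose! y hy using fun r (hr : 0 < r ∧ r < r₀) => hpor r hr.1 hr.2
  obtain ⟨K, hK⟩ := exists_nat_ge (C / κ)
  have hev : ∀ᶠ r in 𝓝[>] (0 : ℝ), 0 < r ∧ r < r₀ := Ioo_mem_nhdsGT hr₀
  have hδ : Tendsto (fun r : ℝ => κ * r) (𝓝[>] 0) (𝓝[>] 0) := by
    refine tendsto_nhdsWithin_iff.2 ⟨?_, ?_⟩
    · have : Tendsto (fun r : ℝ => κ * r) (𝓝 0) (𝓝 (κ * 0)) := tendsto_id.const_mul κ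
      rw [mul_zero] at this
      exact this.mono_left nhdsWithin_le_nhds
    · filter_upwards [hev] with r hr using mul_pos hκ hr.1
  have hlim := hdens K y (fun r => κ * r) hδ (by
    filter_upwards [hev] with r hr
    rw [mem_closedBall]
    refine (hy r hr).1.trans ?_
    rw [div_le_iff₀ hκ] at hK
    nlinarith [hr.1])
  have hzero : Tendsto
      (fun r => μ (E ∩ closedBall (y r) (κ * r)) / μ (closedBall (y r) (κ * r)))
      (𝓝[>] (0 : ℝ)) (𝓝 0) := by
    refine tendsto_const_nhds.congr' ?_
    filter_upwards [hev] with r hr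
    rw [(hy r hr).2.inter_eq, measure_empty, ENNReal.zero_div]
  exact zero_ne_one (tendsto_nhds_unique hzero hlim)

/-- The zero set of a continuous function is null if almost every point of almost every line
through some given point is not in it. -/
theorem measure_zeros_eq_zero {V : Type*} [NormedAddCommGroup V] [NormedSpace ℝ V]
    [FiniteDimensional ℝ V] [MeasurableSpace V] [BorelSpace V] (μ : Measure V)
    [μ.IsAddHaarMeasure] {f : V → ℝ} (hf : Continuous f) (x₀ : V)
    (h : ∀ x, volume {t : ℝ | f (x₀ + t • x) = 0} = 0) : μ {x | f x = 0} = 0 := by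
  have hclosed : IsClosed {p : ℝ × V | f (x₀ + p.1 • p.2) = 0} :=
    isClosed_eq (by fun_prop) continuous_const
  -- Fubini: every slice in t is null, so almost every slice in x is null. One such t ≠ 0 suffices,
  -- because the zero set is an affine image of that slice.
  have hprod : (volume.prod μ) {p : ℝ × V | f (x₀ + p.1 • p.2) = 0} = 0 := by
    rw [Measure.prod_apply_symm hclosed.measurableSet]
    simp only [Set.preimage_ofPred_eq, h, lintegral_zero]
  have hae := (Measure.measure_prod_null hclosed.measurableSet).1 hprod
  obtain ⟨t, ht, ht₀⟩ := (hae.and (Measure.ae_ne volume (0 : ℝ))).exists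
  have ht : μ {x | f (x₀ + t • x) = 0} = 0 := ht
  have himage : {x | f x = 0} = (fun x => x₀ + x) '' (t • {x | f (x₀ + t • x) = 0}) := by
    ext x
    constructor
    · intro hx
      have hx' : x₀ + t • t⁻¹ • (x - x₀) = x := by rw [smul_inv_smul₀ ht₀]; abel
      refine ⟨t • t⁻¹ • (x - x₀), Set.smul_mem_smul_set ?_, hx'⟩
      change f _ = 0
      rw [hx']
      exact hx
    · rintro ⟨_, ⟨y, hy, rfl⟩, rfl⟩
      exact hy
  rw [himage, Set.image_add_left, measure_preimage_add, Measure.addHaar_smul, ht, mul_zero]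

/-- A line through an invertible matrix contains only finitely many singular matrices. -/
theorem finite_det_add_smul_eq_zero {m : Type*} [Fintype m] [DecidableEq m] {A : Matrix m m ℝ}
    (hA : A.det ≠ 0) (B : Matrix m m ℝ) : {t : ℝ | (A + t • B).det = 0}.Finite := by
  -- The determinant along the line is a polynomial in t whose value at 0 is `A.det`, so it is not
  -- the zero polynomial.
  let p : Polynomial ℝ := (A.map Polynomial.C + (Polynomial.X : Polynomial ℝ) • B.map Polynomial.C).det
  have heval : ∀ t, p.eval t = (A + t • B).det := by
    intro t
    rw [← Polynomial.coe_evalRingHom, RingHom.map_det]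
    congr 1
    ext i j
    simp
    exact mul_comm _ _
  have hp : p ≠ 0 := by
    intro h
    apply hA
    simpa [h] using (heval 0).symm
  refine (Polynomial.finite_setOfPred_isRoot hp).subset fun t ht => ?_
  change p.eval t = 0
  rw [heval]
  exact ht

namespace Grassmannian

variable {n l : ℕ}

/-! ### Sets of measure zero in the Grassmannian -/

theorem HasMeasureZero.mono {A B : Set (Grassmannian n l)} (hB : HasMeasureZero B) (h : A ⊆ B) :
    HasMeasureZero A := fun φ hφ =>
  measure_mono_null (Set.image_mono (Set.inter_subset_inter_left _ h)) (hB φ hφ)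

theorem HasMeasureZero.iUnion {ι : Sort*} [Countable ι] {A : ι → Set (Grassmannian n l)}
    (h : ∀ i, HasMeasureZero (A i)) : HasMeasureZero (⋃ i, A i) := by
  intro φ hφ
  rw [Set.iUnion_inter, Set.image_iUnion]
  exact measure_iUnion_null fun i => h i φ hφ

theorem chart_mem_maximalAtlas (K : IndexSet n l) :
    chart K ∈ IsManifold.maximalAtlas 𝓘(ℝ, Model n l) ∞ (Grassmannian n l) :=
  IsManifold.subset_maximalAtlas (Set.mem_range_self K)

/-- To check that a set contained in a standard chart domain has measure zero, that chart
suffices. -/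
theorem hasMeasureZero_of_coord {K : IndexSet n l} {A : Set (Grassmannian n l)}
    (hA : A ⊆ chartDomain K) (h : volume (coord K '' A) = 0) : HasMeasureZero A := by
  intro φ hφ
  have hmem := IsManifold.compatible_of_mem_maximalAtlas (chart_mem_maximalAtlas K) hφ
  have hdiff : ContDiffOn ℝ ∞ (fun M => φ (coordInv K M)) (coordInv K ⁻¹' φ.source) := by
    rw [contDiffGroupoid, mem_groupoid_of_pregroupoid] at hmem
    simpa [contDiffPregroupoid, chart, Function.comp_def] using hmem.1
  have hsub : coord K '' (A ∩ φ.source) ⊆ coordInv K ⁻¹' φ.source := by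
    rintro _ ⟨ν, hν, rfl⟩
    rw [Set.mem_preimage, coordInv_coord K (hA hν.1)]
    exact hν.2
  have himage : φ '' (A ∩ φ.source)
      = (fun M => φ (coordInv K M)) '' (coord K '' (A ∩ φ.source)) := by
    rw [Set.image_image]
    refine Set.image_congr fun ν hν => ?_
    rw [coordInv_coord K (hA hν.1)]
  rw [himage]
  -- The transition map is differentiable between spaces of equal dimension, so it maps null sets to
  -- null sets.
  refine addHaar_image_eq_zero_of_differentiableOn_of_addHaar_eq_zero volume
    ((hdiff.differentiableOn (by simp)).mono hsub) ?_
  exact measure_mono_null (Set.image_mono Set.inter_subset_left) h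

theorem isOpenEmbedding_coordInv (K : IndexSet n l) : IsOpenEmbedding (coordInv K) :=
  (chart K).symm.isOpenEmbedding rfl

/-- A set of measure zero has empty interior. -/
theorem HasMeasureZero.interior_eq_empty {A : Set (Grassmannian n l)} (h : HasMeasureZero A) :
    interior A = ∅ := by
  rw [Set.eq_empty_iff_forall_notMem]
  intro ν hν
  obtain ⟨K, hK⟩ := exists_mem_chartDomain ν
  have hopen : IsOpen (chart K '' (interior A ∩ (chart K).source)) :=
    (chart K).isOpen_image_of_subset_source (isOpen_interior.inter (chart K).open_source)
      Set.inter_subset_right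
  have hnull := (h.mono interior_subset) (chart K) (chart_mem_maximalAtlas K)
  rw [hopen.measure_eq_zero_iff (μ := volume)] at hnull
  exact Set.eq_empty_iff_forall_notMem.1 hnull _ ⟨ν, ⟨hν, hK⟩, rfl⟩

theorem HasMeasureZero.isMeagre {A : Set (Grassmannian n l)} (h : HasMeasureZero A)
    (hA : IsClosed A) : IsMeagre A :=
  IsNowhereDense.isMeagre (hA.isNowhereDense_iff.2 h.interior_eq_empty)

/-! ### Generic subspaces -/

instance : Finite (IndexSet n l) :=
  Finite.of_injective IndexSet.toFinset fun I J h => by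
    cases I; cases J; simpa using h

/-- The identity block does not depend on the chart point, so subtracting `stack I 0` removes it
from the direction. A line in a chart becomes a line of matrices, along which minors are
polynomials. -/
theorem stack_add_smul (I : IndexSet n l) (M N : Model n l) (t : ℝ) :
    stack I (M + t • N) = stack I M + t • (stack I N - stack I 0) := by
  ext i j
  by_cases h : i ∈ I.toFinset <;> simp [stack, h]

/-- Some subspace lies in all the standard chart domains. -/
theorem exists_det_stack_ne_zero (I : IndexSet n l) :
    ∃ M : Model n l, ∀ K : IndexSet n l, ((stack I M).submatrix K.row id).det ≠ 0 := by
  -- A Vandermonde matrix with distinct nodes: any l of its rows form an invertible matrix.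
  let Y : Matrix (Fin n) (Fin l) ℝ := Matrix.of fun i j => (i : ℝ) ^ (j : ℕ)
  have hY : ∀ K : IndexSet n l, (Y.submatrix K.row id).det ≠ 0 := by
    intro K
    have : Y.submatrix K.row id = Matrix.vandermonde fun a => ((K.row a : Fin n) : ℝ) := by
      ext; simp [Y, Matrix.vandermonde]
    rw [this, Matrix.det_vandermonde_ne_zero_iff]
    intro a b hab
    apply K.row.injective
    exact Fin.val_injective (Nat.cast_injective hab)
  have hinj := mulVec_injective_of_det (hY I)
  let ν : Grassmannian n l := ⟨colSpan Y, finrank_colSpan hinj⟩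
  have hν : ∀ K, ν ∈ chartDomain K := fun K => ⟨Y, rfl, hY K⟩
  refine ⟨coord I ν, fun K => ?_⟩
  have hK : coordInv I (coord I ν) ∈ chartDomain K := by
    rw [coordInv_coord I (hν I)]
    exact hν K
  exact det_ne_zero_of_mem hK rfl (mulVec_injective_of_det (det_stack_row I _))

/-- The complement of each standard chart domain has measure zero. -/
theorem hasMeasureZero_compl_chartDomain (K : IndexSet n l) :
    HasMeasureZero (chartDomain K)ᶜ := by
  have hcover : (chartDomain K)ᶜ ⊆ ⋃ I : IndexSet n l, chartDomain I \ chartDomain K := by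
    intro ν hν
    obtain ⟨I, hI⟩ := exists_mem_chartDomain ν
    exact Set.mem_iUnion.2 ⟨I, hI, hν⟩
  refine (HasMeasureZero.iUnion fun I => ?_).mono hcover
  refine hasMeasureZero_of_coord Set.sdiff_subset ?_
  obtain ⟨M₀, hM₀⟩ := exists_det_stack_ne_zero I
  have hcont : Continuous fun M : Model n l => ((stack I M).submatrix K.row id).det := by
    have hstack : Continuous (stack I) :=
      continuous_matrix fun i j => (contDiff_stack_apply I i j).continuous
    exact (hstack.matrix_submatrix _ _).matrix_det
  refine measure_mono_null ?_ (measure_zeros_eq_zero volume hcont M₀ fun N => ?_)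
  · rintro _ ⟨ν, hν, rfl⟩
    by_contra hdet
    apply hν.2
    rw [← coordInv_coord I hν.1]
    exact ⟨stack I (coord I ν), rfl, hdet⟩
  · simp only [stack_add_smul, Matrix.submatrix_add, Matrix.submatrix_smul, Pi.add_apply,
      Pi.smul_apply]
    exact (finite_det_add_smul_eq_zero (hM₀ K) _).measure_zero volume

/-- If z = Yc vanished on l indices R, then invertibility of the rows of Y indexed by R would force
c = 0. Hence S has at most l elements and can be enlarged to exactly l. -/
theorem exists_superset_of_generic {ν : Grassmannian n l} (hν : ∀ K, ν ∈ chartDomain K)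
    {z : EuclideanSpace ℝ (Fin n)} (hz : z ∈ ν.toSubmodule) (hz₀ : z ≠ 0) {S : Finset (Fin n)}
    (hS : ∀ i ∈ S, z i = 0) : ∃ K : IndexSet n l, S ⊆ K.toFinset := by
  have hcard : S.card ≤ l := by
    by_contra! hlt
    obtain ⟨R, hRS, hR⟩ := Finset.exists_subset_card_eq hlt.le
    obtain ⟨Y, hY, hdet⟩ := hν ⟨R, hR⟩
    rw [← hY, mem_colSpan] at hz
    obtain ⟨c, rfl⟩ := hz
    apply hz₀
    have hc : c = 0 := by
      apply Matrix.mulVec_injective_of_det_ne_zero hdet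
      rw [Matrix.mulVec_zero]
      funext a
      exact hS _ (hRS (row_mem ⟨R, hR⟩ a))
    rw [hc, Matrix.mulVec_zero, WithLp.toLp_zero]
  obtain ⟨I, -⟩ := exists_mem_chartDomain ν
  have hl : l ≤ (Finset.univ : Finset (Fin n)).card := by
    rw [← I.card_eq]
    exact Finset.card_le_univ _
  obtain ⟨K, hSK, -, hK⟩ := Finset.exists_subsuperset_card_eq (Finset.subset_univ S) hcard hl
  exact ⟨⟨K, hK⟩, hSK⟩

end Grassmannian

open Grassmannian

variable {n l : ℕ}

/-! ### Subspaces avoiding the vectors dominated on a given set of indices -/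

/-- The subspaces all of whose nonzero vectors have smaller cost on `T` than off `T`. -/
def recoverySet (l : ℕ) (F : ℝ≥0 → ℝ≥0) (T : Finset (Fin n)) : Set (Grassmannian n l) :=
  {ν | ∀ z ∈ ν.toSubmodule, z ≠ 0 → cost F T z < cost F Tᶜ z}

/-- The cone generated by the vectors whose cost on `T` is at least the cost off `T`. -/
def badCone (F : ℝ≥0 → ℝ≥0) (T : Finset (Fin n)) : Set (Fin n → ℝ) :=
  {v | ∃ t : ℝ, 0 < t ∧ cost F Tᶜ (WithLp.toLp 2 (t • v)) ≤ cost F T (WithLp.toLp 2 (t • v))}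

/-- `F` need not be homogeneous, so the cost inequality alone is not scale invariant. Passing to the
cone permits normalisation to the unit sphere. -/
theorem smul_mem_badCone {F : ℝ≥0 → ℝ≥0} {T : Finset (Fin n)} {v : Fin n → ℝ}
    (hv : v ∈ badCone F T) {a : ℝ} (ha : 0 < a) : a • v ∈ badCone F T := by
  obtain ⟨t, ht, h⟩ := hv
  refine ⟨t * a⁻¹, mul_pos ht (inv_pos.2 ha), ?_⟩
  rwa [smul_smul, mul_assoc, inv_mul_cancel₀ ha.ne', mul_one]

theorem nnabs_le_nnabs {a b : ℝ} (h : |a| ≤ |b|) : Real.nnabs a ≤ Real.nnabs b := by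
  rw [← NNReal.coe_le_coe]
  simpa using h

/-- The cone is stable under enlarging entries on `T` and shrinking entries off `T`. -/
theorem mem_badCone_of_dominated {F : ℝ≥0 → ℝ≥0} (hF : Monotone F) {T : Finset (Fin n)}
    {v w : Fin n → ℝ} (hv : v ∈ badCone F T) (h₁ : ∀ i ∈ T, |v i| ≤ |w i|)
    (h₂ : ∀ i ∉ T, |w i| ≤ |v i|) : w ∈ badCone F T := by
  obtain ⟨t, ht, h⟩ := hv
  have hscale : ∀ a b : ℝ, |a| ≤ |b| → F (Real.nnabs (t * a)) ≤ F (Real.nnabs (t * b)) := by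
    intro a b hab
    apply hF
    apply nnabs_le_nnabs
    rw [abs_mul, abs_mul]
    exact mul_le_mul_of_nonneg_left hab (abs_nonneg t)
  refine ⟨t, ht, le_trans (Finset.sum_le_sum fun i hi => ?_)
    (h.trans (Finset.sum_le_sum fun i hi => ?_))⟩
  · exact hscale _ _ (h₂ i (Finset.mem_compl.1 hi))
  · exact hscale _ _ (h₁ i hi)

/-- Replacing the bad vectors by the cone they generate loses nothing, since a subspace contains all
multiples of its vectors. -/
theorem coordInv_notMem_recoverySet {F : ℝ≥0 → ℝ≥0} {T : Finset (Fin n)} {K : IndexSet n l}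
    {M : Model n l} :
    coordInv K M ∉ recoverySet l F T ↔ ∃ c : Fin l → ℝ, c ≠ 0 ∧ stack K M *ᵥ c ∈ badCone F T := by
  have hinj := mulVec_injective_of_det (det_stack_row K M)
  simp only [recoverySet, Set.mem_ofPred_eq, not_forall, not_lt]
  constructor
  · rintro ⟨z, hz, hz₀, hle⟩
    obtain ⟨c, rfl⟩ := mem_colSpan.1 hz
    refine ⟨c, ?_, 1, one_pos, ?_⟩
    · rintro rfl
      exact hz₀ (by rw [Matrix.mulVec_zero, WithLp.toLp_zero])
    · rwa [one_smul]
  · rintro ⟨c, hc, t, ht, hle⟩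
    refine ⟨WithLp.toLp 2 (t • stack K M *ᵥ c), ?_, ?_, hle⟩
    · exact mem_colSpan.2 ⟨t • c, by rw [Matrix.mulVec_smul]⟩
    · intro h
      have h' : stack K M *ᵥ (t • c) = stack K M *ᵥ 0 := by
        rw [Matrix.mulVec_smul, Matrix.mulVec_zero]
        simpa using h
      exact (smul_ne_zero ht.ne' hc) (hinj h')

theorem continuous_stack_mulVec (K : IndexSet n l) :
    Continuous fun p : Model n l × (Fin l → ℝ) => stack K p.1 *ᵥ p.2 := by
  have hstack : Continuous (stack K) :=
    continuous_matrix fun i j => (contDiff_stack_apply K i j).continuous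
  exact (hstack.comp continuous_fst).matrix_mulVec continuous_snd

/-- A subspace that is not in the interior contains a nonzero vector of the closed cone. -/
theorem exists_mem_closure_badCone {F : ℝ≥0 → ℝ≥0} {T : Finset (Fin n)} {K : IndexSet n l}
    {M : Model n l} (h : coordInv K M ∉ interior (recoverySet l F T)) :
    ∃ c : Fin l → ℝ, c ≠ 0 ∧ stack K M *ᵥ c ∈ closure (badCone F T) := by
  by_contra! hne
  let C : Set (Model n l) :=
    {N | ∃ c ∈ sphere (0 : Fin l → ℝ) 1, stack K N *ᵥ c ∈ closure (badCone F T)}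
  have hC : IsClosed C := by
    have hcl : IsClosed {p : Model n l × sphere (0 : Fin l → ℝ) 1 |
        stack K p.1 *ᵥ (p.2 : Fin l → ℝ) ∈ closure (badCone F T)} :=
      isClosed_closure.preimage ((continuous_stack_mulVec K).comp
        (continuous_fst.prodMk (continuous_subtype_val.comp continuous_snd)))
    -- `C` is the projection of a closed set along the compact sphere, hence closed. Its complement
    -- is an open set of points whose subspaces satisfy the condition.
    convert isClosedMap_fst_of_compactSpace _ hcl using 1
    ext N
    simp [C]
  have hsub : coordInv K '' Cᶜ ⊆ recoverySet l F T := by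
    rintro _ ⟨N, hN, rfl⟩
    by_contra hbad
    obtain ⟨c, hc, hmem⟩ := coordInv_notMem_recoverySet.1 hbad
    refine hN ⟨‖c‖⁻¹ • c, ?_, subset_closure ?_⟩
    · rw [mem_sphere_zero_iff_norm, norm_smul, norm_inv, norm_norm,
        inv_mul_cancel₀ (norm_ne_zero_iff.2 hc)]
    · rw [Matrix.mulVec_smul]
      exact smul_mem_badCone hmem (inv_pos.2 (norm_pos_iff.2 hc))
  refine h (interior_maximal hsub
    ((isOpenEmbedding_coordInv K).isOpenMap _ hC.isOpen_compl) ⟨M, ?_, rfl⟩)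
  rintro ⟨c, hc, hmem⟩
  refine hne c ?_ hmem
  rintro rfl
  simp at hc

/-! ### Porosity from pushing vectors into the cone -/

/-- The direction, entry by entry, that increases `|u i|` on `T` and decreases it off `T`. -/
noncomputable def pushDirection (T : Finset (Fin n)) (u : Fin n → ℝ) (i : Fin n) : ℝ :=
  if i ∈ T then (if 0 ≤ u i then 1 else -1)
  -- A zero entry off `T` cannot be shrunk and has to stay put.
  else if u i = 0 then 0 else if 0 < u i then -1 else 1

theorem abs_pushDirection_le (T : Finset (Fin n)) (u : Fin n → ℝ) (i : Fin n) :
    |pushDirection T u i| ≤ 1 := by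
  unfold pushDirection
  split_ifs <;> simp

/-- A vector v of the cone within r/2 of u dominates w: the push by r absorbs both the error r/2 of
v and the error r/2 of w. The bound r ≤ |u i| keeps an entry off `T` from overshooting zero so far
that its absolute value exceeds that of v. -/
theorem mem_badCone_of_near_push {F : ℝ≥0 → ℝ≥0} (hF : Monotone F) {T : Finset (Fin n)}
    {u w : Fin n → ℝ} (hu : u ∈ closure (badCone F T)) {r : ℝ} (hr : 0 < r)
    (hru : ∀ i, u i ≠ 0 → r ≤ |u i|) (hw : ∀ i, |w i - (u i + r * pushDirection T u i)| ≤ r / 2)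
    (hw₀ : ∀ i ∉ T, u i = 0 → w i = 0) : w ∈ badCone F T := by
  obtain ⟨v, hv, hdist⟩ := Metric.mem_closure_iff.1 hu (r / 2) (half_pos hr)
  have hvu : ∀ i, |u i - v i| ≤ r / 2 := fun i =>
    ((dist_le_pi_dist u v i).trans hdist.le)
  refine mem_badCone_of_dominated hF hv (fun i hi => ?_) fun i hi => ?_
  · have h₁ := abs_le.1 (hw i)
    have h₂ := abs_le.1 (hvu i)
    simp only [pushDirection, hi, if_true] at h₁
    split_ifs at h₁ with h₀
    · exact (abs_le.2 ⟨by linarith, by linarith⟩).trans (le_abs_self (w i))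
    · exact (abs_le.2 ⟨by linarith, by linarith⟩).trans (neg_le_abs (w i))
  · by_cases hzero : u i = 0
    · rw [hw₀ i hi hzero, abs_zero]
      exact abs_nonneg _
    have h₁ := abs_le.1 (hw i)
    have h₂ := abs_le.1 (hvu i)
    have h₃ := hru i hzero
    simp only [pushDirection, hi, if_false, hzero] at h₁
    split_ifs at h₁ with h₀
    · rw [abs_of_pos h₀] at h₃
      exact (abs_le.2 ⟨by linarith, by linarith⟩).trans (le_abs_self (v i))
    · rw [abs_of_nonpos (not_lt.1 h₀)] at h₃
      exact (abs_le.2 ⟨by linarith, by linarith⟩).trans (neg_le_abs (v i))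

theorem stack_mulVec_row (K : IndexSet n l) (M : Model n l) (c : Fin l → ℝ) (a : Fin l) :
    (stack K M *ᵥ c) (K.row a) = c a := by
  have h : ((stack K M).submatrix K.row id *ᵥ c) a = c a := by
    rw [stack_row, Matrix.one_mulVec]
  exact h

theorem stack_mulVec_coRow (K : IndexSet n l) (M : Model n l) (c : Fin l → ℝ)
    (b : Fin (n - l)) : (stack K M *ᵥ c) (K.coRow b) = M b ⬝ᵥ c :=
  congrArg (· ⬝ᵥ c) (congrFun (stack_coRow K M) b)

theorem row_or_coRow (K : IndexSet n l) (i : Fin n) :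
    (∃ a, K.row a = i) ∨ ∃ b, K.coRow b = i := by
  by_cases hi : i ∈ K.toFinset
  · left
    change i ∈ Set.range K.row
    rw [IndexSet.row, Finset.range_orderEmbOfFin]
    exact hi
  · right
    change i ∈ Set.range K.coRow
    rw [IndexSet.coRow, Finset.range_orderEmbOfFin]
    simpa using hi

theorem abs_dotProduct_le {m : Type*} [Fintype m] {x y : m → ℝ} {B : ℝ}
    (h : ∀ a, |y a| ≤ B) : |x ⬝ᵥ y| ≤ (∑ a, |x a|) * B := by
  rw [dotProduct, Finset.sum_mul]
  refine (Finset.abs_sum_le_sum_abs _ _).trans (Finset.sum_le_sum fun a _ => ?_)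
  rw [abs_mul]
  exact mul_le_mul_of_nonneg_left (h a) (abs_nonneg _)

/-- If a vector of the closed cone vanishes off `T` only at indices in `K`, then near the subspace,
in the chart of `K`, there are proportionally large balls of subspaces meeting the cone. -/
theorem exists_closedBall_notMem_recoverySet {F : ℝ≥0 → ℝ≥0} (hF : Monotone F)
    {T : Finset (Fin n)} {K : IndexSet n l} {M : Model n l} {c : Fin l → ℝ} (hc : c ≠ 0)
    (hmem : stack K M *ᵥ c ∈ closure (badCone F T))
    (hzero : ∀ i ∉ T, (stack K M *ᵥ c) i = 0 → i ∈ K.toFinset) :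
    ∃ C : ℝ, ∃ κ > 0, ∃ r₀ > 0, ∀ r, 0 < r → r < r₀ → ∃ N : Model n l,
      dist M N ≤ C * r ∧ ∀ N' ∈ closedBall N (κ * r), coordInv K N' ∉ recoverySet l F T := by
  obtain ⟨a₀, ha₀⟩ : ∃ a, c a ≠ 0 := Function.ne_iff.1 hc
  set u := stack K M *ᵥ c with hu
  set s := pushDirection T u with hs
  set D : ℝ := 1 + ∑ b, ∑ a, |M b a| with hD
  have hDrow : ∀ b, 1 + ∑ a, |M b a| ≤ D := fun b => by
    have := Finset.single_le_sum (f := fun b => ∑ a, |M b a|)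
      (fun b _ => Finset.sum_nonneg fun a _ => abs_nonneg (M b a)) (Finset.mem_univ b)
    simpa [hD] using this
  have hD₀ : 0 ≤ D := by positivity
  set L : ℝ := ∑ a, (|c a| + 1) with hL
  have hL₀ : 0 ≤ L := by positivity
  obtain ⟨ρ, hρ, hρu⟩ : ∃ ρ > 0, ∀ i, u i ≠ 0 → ρ ≤ |u i| := by
    by_cases hne : (Finset.univ.filter fun i => u i ≠ 0).Nonempty
    · obtain ⟨i₀, hi₀, hmin⟩ := Finset.exists_min_image _ (fun i => |u i|) hne
      exact ⟨|u i₀|, abs_pos.2 (Finset.mem_filter.1 hi₀).2, fun i hi => hmin i (by simpa using hi)⟩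
    · refine ⟨1, one_pos, fun i hi => absurd ⟨i, ?_⟩ hne⟩
      simpa using hi
  -- D bounds the defect of M at the new coefficients, divided later by an entry of size at least |c
  -- a₀| / 2. L bounds the sum of the |c' a|, so κ makes the error over the ball at most r / 2. The
  -- three bounds on r keep nonzero entries of u above r, the bound L valid, and c' a₀ away from
  -- zero.
  refine ⟨D * (2 / |c a₀|), 1 / (2 * (L + 1)), by positivity,
    min ρ (min 1 (|c a₀| / 2)), by positivity, fun r hr hlt => ?_⟩
  have hrρ : r < ρ := hlt.trans_le (min_le_left _ _)
  have hr1 : r < 1 := hlt.trans_le ((min_le_right _ _).trans (min_le_left _ _))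
  have hrc : r < |c a₀| / 2 := hlt.trans_le ((min_le_right _ _).trans (min_le_right _ _))
  -- These coefficients realise the pushed entries on K exactly.
  set c' : Fin l → ℝ := fun a => c a + r * s (K.row a) with hc'
  have hrs : ∀ i, |r * s i| ≤ r := fun i => by
    rw [abs_mul, abs_of_pos hr]
    exact mul_le_of_le_one_right hr.le (abs_pushDirection_le T u i)
  have hc'a : |c a₀| / 2 ≤ |c' a₀| := by
    have h1 := abs_sub_abs_le_abs_sub (c a₀) (-(r * s (K.row a₀)))
    rw [abs_neg, sub_neg_eq_add] at h1
    have := hrs (K.row a₀)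
    change _ ≤ |c a₀ + r * s (K.row a₀)|
    linarith
  have hc'a₀ : 0 < |c' a₀| := lt_of_lt_of_le (half_pos (abs_pos.2 ha₀)) hc'a
  have hc'L : ∑ a, |c' a| ≤ L := by
    refine Finset.sum_le_sum fun a _ => (abs_add_le _ _).trans ?_
    have := hrs (K.row a)
    linarith
  -- Altering column a₀ alone corrects each remaining row, so that `stack K N *ᵥ c'` is exactly the
  -- pushed vector.
  set e : Fin (n - l) → ℝ :=
    fun b => (u (K.coRow b) + r * s (K.coRow b) - M b ⬝ᵥ c') / c' a₀ with he
  let N : Model n l := fun b => M b + Pi.single a₀ (e b)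
  have hN : ∀ b, N b ⬝ᵥ c' = u (K.coRow b) + r * s (K.coRow b) := fun b => by
    change (M b + Pi.single a₀ (e b)) ⬝ᵥ c' = _
    rw [add_dotProduct, single_dotProduct, he]
    have := abs_pos.1 hc'a₀
    field_simp
    ring
  have hdef : ∀ b, |u (K.coRow b) + r * s (K.coRow b) - M b ⬝ᵥ c'| ≤ D * r := fun b => by
    have h1 : M b ⬝ᵥ c' = u (K.coRow b) + M b ⬝ᵥ fun a => r * s (K.row a) := by
      rw [hu, stack_mulVec_coRow, ← dotProduct_add]
      rfl
    have h2 := abs_dotProduct_le (x := M b) (y := fun a => r * s (K.row a)) (B := r)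
      fun a => hrs _
    have h3 := hrs (K.coRow b)
    have h4 := mul_le_mul_of_nonneg_right (hDrow b) hr.le
    rw [h1, add_sub_add_left_eq_sub]
    refine (abs_sub _ _).trans ?_
    linarith
  refine ⟨N, ?_, fun N' hN' => ?_⟩
  · rw [dist_pi_le_iff (by positivity)]
    intro b
    rw [dist_pi_le_iff (by positivity)]
    intro a
    have he' : |e b| ≤ D * (2 / |c a₀|) * r := by
      rw [he]
      change |_ / _| ≤ _
      rw [abs_div, div_le_iff₀ hc'a₀]
      calc _ ≤ D * r := hdef b
        _ = D * (2 / |c a₀|) * r * (|c a₀| / 2) := by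
          have := abs_pos.2 ha₀
          field_simp
        _ ≤ _ := by gcongr
    change |M b a - (M b a + (Pi.single a₀ (e b) : Fin l → ℝ) a)| ≤ _
    rw [sub_add_cancel_left, abs_neg]
    by_cases ha : a = a₀
    · subst ha
      simpa using he'
    · rw [Pi.single_eq_of_ne ha, abs_zero]
      positivity
  · rw [coordInv_notMem_recoverySet]
    refine ⟨c', fun h => ?_, mem_badCone_of_near_push hF hmem hr
      (fun i hi => hrρ.le.trans (hρu i hi)) (fun i => ?_) fun i hi hui => ?_⟩
    · rw [h] at hc'a₀
      simp at hc'a₀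
    · obtain ⟨a, rfl⟩ | ⟨b, rfl⟩ := row_or_coRow K i
      · rw [stack_mulVec_row, hu, stack_mulVec_row, ← hu, ← hs, sub_self, abs_zero]
        exact (half_pos hr).le
      · rw [stack_mulVec_coRow, ← hs, ← hN, ← sub_dotProduct, dotProduct_comm]
        refine (abs_dotProduct_le (B := 1 / (2 * (L + 1)) * r) fun a => ?_).trans ?_
        · exact (dist_le_pi_dist (N' b) (N b) a).trans
            ((dist_le_pi_dist N' N b).trans (mem_closedBall.1 hN'))
        · calc (∑ a, |c' a|) * (1 / (2 * (L + 1)) * r) ≤ (L + 1) * (1 / (2 * (L + 1)) * r) := by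
                gcongr
                linarith
            _ = r / 2 := by field_simp
    -- A zero entry off `T` lies in K, so its new value is c' a for every N'. It is zero because
    -- both c a and the push vanish there.
    · obtain ⟨a, rfl⟩ : i ∈ Set.range K.row := by
        rw [IndexSet.row, Finset.range_orderEmbOfFin]
        exact hzero i hi hui
      have hca : c a = 0 := by rwa [hu, stack_mulVec_row] at hui
      rw [stack_mulVec_row, hc']
      simp [hca, hs, pushDirection, hi, hui]

/-! ### The boundary of the exact recovery set -/

theorem hasMeasureZero_frontier_recoverySet (l : ℕ) {F : ℝ≥0 → ℝ≥0} (hF : Monotone F)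
    (T : Finset (Fin n)) :
    HasMeasureZero (closure (recoverySet l F T) \ interior (recoverySet l F T)) := by
  let E : IndexSet n l → Set (Grassmannian n l) := fun K =>
    {ν | ν ∈ closure (recoverySet l F T) ∧ ν ∈ chartDomain K ∧ ∃ c : Fin l → ℝ, c ≠ 0 ∧
      stack K (coord K ν) *ᵥ c ∈ closure (badCone F T) ∧
      ∀ i ∉ T, (stack K (coord K ν) *ᵥ c) i = 0 → i ∈ K.toFinset}
  have hE : ∀ K, HasMeasureZero (E K) := by
    intro K
    refine hasMeasureZero_of_coord (K := K) (fun ν hν => hν.2.1)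
      (measure_eq_zero_of_porous volume ?_)
    rintro _ ⟨ν, ⟨-, -, c, hc, hmem, hzero⟩, rfl⟩
    obtain ⟨C, κ, hκ, r₀, hr₀, h⟩ := exists_closedBall_notMem_recoverySet hF hc hmem hzero
    -- `E K` lies only in the closure of the recovery set. Halving the radius leaves room to
    -- approximate a point of `E K` by a point of the recovery set inside the larger ball.
    refine ⟨C, κ / 2, half_pos hκ, r₀, hr₀, fun r hr hlt => ?_⟩
    obtain ⟨N, hdist, hN⟩ := h r hr hlt
    refine ⟨N, hdist, Set.disjoint_left.2 ?_⟩
    rintro _ ⟨ν', ⟨hcl, hν', -⟩, rfl⟩ hball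
    have hcl' : coord K ν' ∈ closure (coordInv K ⁻¹' recoverySet l F T) := by
      apply (isOpenEmbedding_coordInv K).isOpenMap.preimage_closure_subset_closure_preimage
      rw [Set.mem_preimage, coordInv_coord K hν']
      exact hcl
    have hκr : 0 < κ / 2 * r := mul_pos (half_pos hκ) hr
    obtain ⟨N', hN', hd⟩ := Metric.mem_closure_iff.1 hcl' (κ / 2 * r) hκr
    refine hN N' ?_ hN'
    rw [mem_closedBall] at hball ⊢
    have := dist_triangle_left N' N (coord K ν')
    linarith
  have hcover : closure (recoverySet l F T) \ interior (recoverySet l F T) ⊆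
      ⋃ K : IndexSet n l, ((chartDomain K)ᶜ ∪ E K) := by
    rintro ν ⟨hcl, hint⟩
    by_cases hgen : ∀ K, ν ∈ chartDomain K
    swap
    · obtain ⟨K, hK⟩ := not_forall.1 hgen
      exact Set.mem_iUnion.2 ⟨K, Or.inl hK⟩
    have hz : ∃ z ∈ ν.toSubmodule, z ≠ 0 ∧ z.ofLp ∈ closure (badCone F T) := by
      obtain ⟨I, hI⟩ := exists_mem_chartDomain ν
      rw [← coordInv_coord I hI] at hint
      obtain ⟨c, hc, hmem⟩ := exists_mem_closure_badCone hint
      refine ⟨WithLp.toLp 2 (stack I (coord I ν) *ᵥ c), ?_, ?_, hmem⟩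
      · have : WithLp.toLp 2 (stack I (coord I ν) *ᵥ c)
            ∈ (coordInv I (coord I ν)).toSubmodule := mem_colSpan.2 ⟨c, rfl⟩
        rwa [coordInv_coord I hI] at this
      · intro h
        apply hc
        apply mulVec_injective_of_det (det_stack_row I (coord I ν))
        rw [Matrix.mulVec_zero]
        simpa using h
    obtain ⟨z, hz, hz₀, hmem⟩ := hz
    -- The vector z was found in an arbitrary chart I; K is chosen afterwards to contain its zero
    -- indices off `T`, and z is rewritten in that chart.
    obtain ⟨K, hK⟩ := exists_superset_of_generic hgen hz hz₀
      (S := Finset.univ.filter fun i => i ∉ T ∧ z i = 0) fun i hi => (Finset.mem_filter.1 hi).2.2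
    have hz' : z ∈ (coordInv K (coord K ν)).toSubmodule := by
      rwa [coordInv_coord K (hgen K)]
    obtain ⟨c, rfl⟩ := mem_colSpan.1 hz'
    refine Set.mem_iUnion.2 ⟨K, Or.inr ⟨hcl, hgen K, c, ?_, hmem, fun i hi h => hK ?_⟩⟩
    · rintro rfl
      exact hz₀ (by rw [Matrix.mulVec_zero, WithLp.toLp_zero])
    · exact Finset.mem_filter.2 ⟨Finset.mem_univ i, hi, h⟩
  refine (HasMeasureZero.iUnion fun K => ?_).mono hcover
  rw [Set.union_eq_iUnion]
  refine HasMeasureZero.iUnion fun b => ?_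
  cases b
  · exact hE K
  · exact hasMeasureZero_compl_chartDomain K

theorem exactRecoverySet_eq_iInter (F : ℝ≥0 → ℝ≥0) (n k l : ℕ) :
    exactRecoverySet F n k l
      = ⋂ T : {T : Finset (Fin n) // T.card ≤ k}, recoverySet l F (T : Finset (Fin n)) := by
  ext ν
  simp only [exactRecoverySet, recoverySet, Set.mem_iInter, Set.mem_ofPred_eq, Subtype.forall]
  exact ⟨fun h T hT z hz hz₀ => h z hz hz₀ T hT, fun h z hz hz₀ T hT => h T hT z hz hz₀⟩

/-- Interior commutes with finite intersections, so a boundary point of the intersection fails to be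
interior for some single `T`, while it lies in the closure for every `T`. -/
theorem hasMeasureZero_frontier_exactRecoverySet {F : ℝ≥0 → ℝ≥0} (hF : Monotone F)
    (n k l : ℕ) :
    HasMeasureZero
      (closure (exactRecoverySet F n k l) \ interior (exactRecoverySet F n k l)) := by
  refine (HasMeasureZero.iUnion fun T : {T : Finset (Fin n) // T.card ≤ k} =>
    hasMeasureZero_frontier_recoverySet l hF (T : Finset (Fin n))).mono ?_
  rw [exactRecoverySet_eq_iInter, interior_iInter_of_finite]
  rintro ν ⟨hcl, hint⟩
  obtain ⟨T, hT⟩ := not_forall.1 (mt Set.mem_iInter.2 hint)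
  exact Set.mem_iUnion.2 ⟨T, closure_mono (Set.iInter_subset _ T) hcl, hT⟩

end SparseRecovery

theorem theorem4 (F : ℝ≥0 → ℝ≥0) (hF : SparseRecovery.IsSparsenessMeasure F)
    (hmono : Monotone F) (n k l : ℕ) :
    SparseRecovery.Grassmannian.HasMeasureZero
        (closure (SparseRecovery.exactRecoverySet F n k l) \
          interior (SparseRecovery.exactRecoverySet F n k l)) ∧
      IsMeagre
        (closure (SparseRecovery.exactRecoverySet F n k l) \
          interior (SparseRecovery.exactRecoverySet F n k l)) := by
  have h := SparseRecovery.hasMeasureZero_frontier_exactRecoverySet hmono n k l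
  exact ⟨h, h.isMeagre isClosed_frontier⟩
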